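/- Let $e_n(x)=\sqrt2\sin(\pi n x)$ and $\lambda_n=\pi^2n^2$, $n\in\mathbb N^+$, be the eigenfunctions and eigenvalues of $-\Delta$ on $(0,1)$ with Dirichlet boundary conditions, and for $s\in[0,1)$ let $H^{-s}(0,1)$ be the space of formal real series $f=\sum_{n\ge1} f_ne_n$ with $\sum_{n\ge1}\lambda_n^{-s}|f_n|^2<\infty$; write $\langle f,e_n\rangle=f_n$. Assume that there are constants $C,\alpha>0$ and $s\in[0,1)$ such that $f\in H^{-s}(0,1)$ and $$|\langle f,e_n\rangle|\ge C e^{-\alpha\pi^2n^2}\qquad\text{for all } n\in\mathbb N^+ .$$ Then for every $T>\alpha$ the controlled heat equation $$\partial_t z-\Delta z=f(x)h(t)\ \text{ in }(0,1)\times(0,T),\qquad z|_{x=0,1}=0,\qquad z(0,\cdot)=z_0,$$ with scalar control $h\in L^2(0,T)$, is null-controllable on $L^2(0,1)$ at time $T$: there is a constant $K>0$ such that for every $z_0\in L^2(0,1)$ there exists $h\in L^2(0,T)$ with $\|h\|_{L^2(0,T)}\le K\|z_0\|_{L^2(0,1)}$ whose mild solution $z\in C([0,T];L^2(0,1))$,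 $$z(t)=S(t)z_0+\int_0^t S(t-r)f\,h(r)\,dr,\qquad S(t)\Big(\sum_{n\ge1} a_ne_n\Big)=\sum_{n\ge1} e^{-\lambda_nt}a_ne_n,$$ satisfies $z(T)=0$. -/

import Mathlib

open MeasureTheory Set

noncomputable section

namespace HeatControl

/-- The real Hilbert space `L²(0,L)` (Lebesgue measure on the open interval `(0,L)`). -/
abbrev L2 (L : ℝ) : Type := Lp ℝ 2 (volume.restrict (Ioo (0 : ℝ) L))

/-- The Dirichlet eigenvalues `λₙ = π² n²` of `-Δ` on `(0,1)`. -/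
def eigenvalue (n : ℕ+) : ℝ := Real.pi ^ 2 * (n : ℝ) ^ 2

/-- The Dirichlet eigenfunctions `√2 sin(π n x)` of `-Δ` on `(0,1)`, as functions. -/
def sineFun (n : ℕ+) (x : ℝ) : ℝ := √2 * Real.sin (Real.pi * n * x)

theorem memLp_sineFun (n : ℕ+) : MemLp (sineFun n) 2 (volume.restrict (Ioo (0 : ℝ) 1)) := by
  refine MemLp.of_bound (C := √2) ?_ ?_
  · have h : Continuous (sineFun n) := by unfold sineFun; fun_prop
    exact h.aestronglyMeasurable
  · refine Filter.Eventually.of_forall fun x => ?_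
    have h := Real.abs_sin_le_one (Real.pi * n * x)
    have h2 := Real.sqrt_nonneg 2
    rw [sineFun, Real.norm_eq_abs, abs_mul, abs_of_nonneg h2]
    exact mul_le_of_le_one_right h2 h

/-- The Dirichlet eigenfunction `eₙ = √2 sin(π n ·)` as an element of `L²(0,1)`. -/
def e (n : ℕ+) : L2 1 := (memLp_sineFun n).toLp (sineFun n)

/-- The spectral Sobolev space `H^{-s}(0,1)`: formal sine series `f = ∑ fₙ eₙ` with
`∑ λₙ^{-s} |fₙ|² < ∞`. The number `coeff n` is `fₙ = ⟨f, eₙ⟩`. -/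
structure NegSobolev (s : ℝ) where
  coeff : ℕ+ → ℝ
  summable_coeff : Summable fun n : ℕ+ => eigenvalue n ^ (-s) * |coeff n| ^ 2

/-- The series `∑ e^{-λₙ t} aₙ eₙ` in `L²(0,1)`: the action at time `t` of the Dirichlet heat
semigroup on the formal sine series `∑ aₙ eₙ`. -/
def heatSeries (a : ℕ+ → ℝ) (t : ℝ) : L2 1 :=
  ∑' n : ℕ+, (Real.exp (-eigenvalue n * t) * a n) • e n

/-- The Dirichlet heat semigroup `S(t) = e^{tΔ}` on `L²(0,1)`, for `t ≥ 0`. -/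
def heat (t : ℝ) (z : L2 1) : L2 1 := heatSeries (fun n => inner ℝ z (e n)) t

/-- The extension of the Dirichlet heat semigroup to `H^{-s}(0,1)`, which maps `H^{-s}(0,1)` into
`L²(0,1)` for `t > 0`. (It is only used for almost every `t > 0`.) -/
def heatExt {s : ℝ} (t : ℝ) (f : NegSobolev s) : L2 1 := heatSeries f.coeff t

/-- `z ∈ C([0,T]; L²(0,1))` is the mild solution of
`∂ₜ z - Δ z = f(x) h(t)` on `(0,1) × (0,T)`, `z = 0` at `x = 0, 1`, `z(0,·) = z₀`, that is
`z(t) = S(t) z₀ + ∫₀ᵗ S(t-r) f h(r) dr` with an `L²(0,1)`-valued Bochner integral. -/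
structure IsMildSolution {s : ℝ} (f : NegSobolev s) (T : ℝ) (h : L2 T) (z₀ : L2 1)
    (z : ℝ → L2 1) : Prop where
  continuousOn : ContinuousOn z (Icc 0 T)
  integrable : ∀ t ∈ Icc 0 T,
    IntervalIntegrable (fun r => h r • heatExt (t - r) f) volume 0 t
  eq_mild : ∀ t ∈ Icc 0 T, z t = heat t z₀ + ∫ r in (0 : ℝ)..t, h r • heatExt (t - r) f

/-- Null-controllability on `L²(0,1)` at time `T` of `∂ₜ z - Δ z = f(x) h(t)` (Dirichlet boundary
conditions), with scalar control `h ∈ L²(0,T)` of cost at most a constant times `‖z₀‖`. -/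
def IsNullControllable {s : ℝ} (f : NegSobolev s) (T : ℝ) : Prop :=
  ∃ K : ℝ, 0 < K ∧ ∀ z₀ : L2 1, ∃ (h : L2 T) (z : ℝ → L2 1),
    IsMildSolution f T h z₀ z ∧ z T = 0 ∧ ‖h‖ ≤ K * ‖z₀‖

end HeatControl

end

/-! The proof is the moment method. Projecting the mild solution on `e k`, the condition z(T) = 0
follows from f_k ∫₀ᵀ h(r) e^{-λ_k(T-r)} dr = -e^{-λ_k T} z_k for all k, where z_k is the coefficient
of z₀. If q_n is biorthogonal to the e^{-λ_k t}, a solution is h(T-t) = -∑ e^{-λ_n T} (z_n/f_n)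
q_n(t). Since 1/|f_n| ≤ C⁻¹ e^{αλ_n}, the series converges uniformly as soon as q_n grows like
e^{ελ_n} with ε < T - α. So the core is `exists_biorthogonal`: q_n living on a short interval (0,τ),
of size O(e^{3τλ_n}).

Take a bump φ on (0,τ) with Laplace transform Φ, and seek g supported in [0,τ] with transform Φ(μ)
sin √μ / √μ, which vanishes at every λ_n. Multiplication by μ^i is differentiation of φ, so g = ∑
(-1)^i φ^(i)/(2i+1)!. This converges if |φ^(i)| ≤ (2i)!/2^i, a Gevrey bound of order 2 that a
product of two functions of type exp(-1/x) satisfies after dilation.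

Dividing the transform by μ - λ_n amounts to solving p' - λ_n p = g, p(0) = 0, that is p(t) = e^{λ_n
t} ∫₀ᵗ g(s) e^{-λ_n s} ds. It vanishes beyond τ because the transform of g is zero at λ_n, and it is
orthogonal to e^{-λ_k t} for k ≠ n. Its pairing with e^{-λ_n t} is the derivative of the transform
of g at λ_n, namely (-1)^n Φ(λ_n)/(2λ_n), and Φ(λ_n) ≥ e^{-λ_n τ} ∫ φ.

The control is continuous and bounded, so the Duhamel series is dominated by |f_n|/λ_n, summable for
f in H^{-s}, s ≤ 1 (`exists_mildSolution`). -/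

noncomputable section

namespace HeatControl

/-! ### Derivative bounds for exp(-1/x). -/

open Polynomial in
/-- The polynomials with `(d/dx)^i exp(-1/x) = Pᵢ(1/x) exp(-1/x)`. -/
def expNegInvPoly : ℕ → ℝ[X]
  | 0 => 1
  | i + 1 => X ^ 2 * (expNegInvPoly i - derivative (expNegInvPoly i))

theorem natDegree_expNegInvPoly_le (i : ℕ) : (expNegInvPoly i).natDegree ≤ 2 * i := by
  induction i with
  | zero => simp [expNegInvPoly]
  | succ i ih =>
    rw [expNegInvPoly]
    refine Polynomial.natDegree_mul_le.trans ?_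
    have h1 := Polynomial.natDegree_sub_le (expNegInvPoly i)
      (Polynomial.derivative (expNegInvPoly i))
    have h2 := Polynomial.natDegree_derivative_le (expNegInvPoly i)
    rw [Polynomial.natDegree_X_pow]
    omega

theorem coeff_expNegInvPoly_succ (i k : ℕ) : (expNegInvPoly (i + 1)).coeff (k + 2) =
    (expNegInvPoly i).coeff k - (expNegInvPoly i).coeff (k + 1) * (k + 1) := by
  rw [expNegInvPoly, mul_comm, Polynomial.coeff_mul_X_pow, Polynomial.coeff_sub,
    Polynomial.coeff_derivative]

theorem coeff_expNegInvPoly_succ_of_lt (i k : ℕ) (hk : k < 2) :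
    (expNegInvPoly (i + 1)).coeff k = 0 := by
  rw [expNegInvPoly, mul_comm, Polynomial.coeff_mul_X_pow', if_neg (by omega)]

/-- The weight k! is the bound of s^k e^{-s} for s = 1/x ≥ 0, so this sum controls the i-th
derivative uniformly in x. In the recursion, (k+2)! is at most (2i+2)(2i+1) k!, and both p_k k! and
p_{k+1} (k+1)! sum to at most the previous sum, whence one factor 2 per step. -/
theorem sum_abs_coeff_expNegInvPoly_le (i : ℕ) :
    ∑ k ∈ Finset.range (2 * i + 1), |(expNegInvPoly i).coeff k| * (k.factorial : ℝ)
      ≤ 2 ^ i * ((2 * i).factorial : ℝ) := by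
  induction i with
  | zero => simp [expNegInvPoly]
  | succ i ih =>
    set p := expNegInvPoly i with hp
    set N := ∑ k ∈ Finset.range (2 * i + 1), |p.coeff k| * (k.factorial : ℝ) with hN
    have hfac : ((2 * (i + 1)).factorial : ℝ)
        = (2 * i + 2) * (2 * i + 1) * ((2 * i).factorial : ℝ) := by
      rw [show 2 * (i + 1) = 2 * i + 1 + 1 by ring, Nat.factorial_succ, Nat.factorial_succ]
      push_cast; ring
    have hshift : ∑ k ∈ Finset.range (2 * i + 1), |p.coeff (k + 1)| * ((k + 1).factorial : ℝ)
        ≤ N := by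
      have hz : p.coeff (2 * i + 1) = 0 :=
        Polynomial.coeff_eq_zero_of_natDegree_lt
          (lt_of_le_of_lt (natDegree_expNegInvPoly_le i) (by omega))
      have h1 := Finset.sum_range_succ' (fun k => |p.coeff k| * (k.factorial : ℝ)) (2 * i + 1)
      have h2 := Finset.sum_range_succ (fun k => |p.coeff k| * (k.factorial : ℝ)) (2 * i + 1)
      rw [h2, hz] at h1
      simp only [abs_zero, zero_mul, add_zero] at h1
      have : 0 ≤ |p.coeff 0| * ((0).factorial : ℝ) := by positivity
      linarith
    have hsplit : ∑ k ∈ Finset.range (2 * (i + 1) + 1),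
        |(expNegInvPoly (i + 1)).coeff k| * (k.factorial : ℝ)
        = ∑ k ∈ Finset.range (2 * i + 1),
          |p.coeff k - p.coeff (k + 1) * (k + 1)| * ((k + 2).factorial : ℝ) := by
      rw [show 2 * (i + 1) + 1 = 2 * i + 1 + 1 + 1 by ring, Finset.sum_range_succ',
        Finset.sum_range_succ', coeff_expNegInvPoly_succ_of_lt i 0 (by omega),
        coeff_expNegInvPoly_succ_of_lt i (0 + 1) (by omega)]
      simp only [abs_zero, zero_mul, add_zero]
      exact Finset.sum_congr rfl fun k _ => by rw [← coeff_expNegInvPoly_succ]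
    rw [hsplit]
    calc _ ≤ ∑ k ∈ Finset.range (2 * i + 1), ((2 * i + 2) * (2 * i + 1) : ℝ) *
          (|p.coeff k| * (k.factorial : ℝ) + |p.coeff (k + 1)| * ((k + 1).factorial : ℝ)) := by
          refine Finset.sum_le_sum fun k hk => ?_
          have hk' : (k : ℝ) ≤ 2 * i := by
            exact_mod_cast Nat.lt_succ_iff.mp (Finset.mem_range.mp hk)
          have habs : |p.coeff k - p.coeff (k + 1) * (k + 1)|
              ≤ |p.coeff k| + |p.coeff (k + 1)| * (k + 1) := by
            refine (abs_sub _ _).trans ?_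
            rw [abs_mul, abs_of_nonneg (by positivity : (0 : ℝ) ≤ k + 1)]
          have hf2 : ((k + 2).factorial : ℝ) = (k + 2) * (k + 1) * (k.factorial : ℝ) := by
            rw [Nat.factorial_succ, Nat.factorial_succ]; push_cast; ring
          have hf1 : ((k + 1).factorial : ℝ) = (k + 1) * (k.factorial : ℝ) := by
            rw [Nat.factorial_succ]; push_cast; ring
          rw [hf2, hf1]
          calc _ ≤ (|p.coeff k| + |p.coeff (k + 1)| * (k + 1)) *
                ((k + 2) * (k + 1) * (k.factorial : ℝ)) := by gcongr
            _ = ((k + 2) * (k + 1) : ℝ) * (|p.coeff k| * (k.factorial : ℝ) +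
                |p.coeff (k + 1)| * ((k + 1) * (k.factorial : ℝ))) := by ring
            _ ≤ _ := by gcongr
      _ ≤ ((2 * i + 2) * (2 * i + 1) : ℝ) * (N + N) := by
          rw [← Finset.mul_sum, Finset.sum_add_distrib]
          gcongr
      _ ≤ ((2 * i + 2) * (2 * i + 1) : ℝ) * (2 * (2 ^ i * ((2 * i).factorial : ℝ))) := by
          gcongr; linarith
      _ = _ := by rw [hfac, pow_succ]; ring

theorem iteratedDeriv_expNegInvGlue (i : ℕ) : iteratedDeriv i expNegInvGlue
    = fun x => (expNegInvPoly i).eval x⁻¹ * expNegInvGlue x := by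
  induction i with
  | zero => ext x; simp [expNegInvPoly]
  | succ i ih =>
    rw [iteratedDeriv_succ, ih]
    ext x
    rw [(expNegInvGlue.hasDerivAt_polynomial_eval_inv_mul _ x).deriv, expNegInvPoly]

theorem abs_iteratedDeriv_expNegInvGlue_le (i : ℕ) (x : ℝ) :
    |iteratedDeriv i expNegInvGlue x| ≤ 2 ^ i * ((2 * i).factorial : ℝ) := by
  rw [iteratedDeriv_expNegInvGlue]
  dsimp only
  rcases le_or_gt x 0 with hx | hx
  · rw [expNegInvGlue.zero_of_nonpos hx]; simp
  · refine le_trans ?_ (sum_abs_coeff_expNegInvPoly_le i)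
    have hs : 0 < x⁻¹ := inv_pos.2 hx
    rw [expNegInvGlue, if_neg hx.not_ge,
      Polynomial.eval_eq_sum_range' (Nat.lt_succ_of_le (natDegree_expNegInvPoly_le i)),
      Finset.sum_mul]
    refine (Finset.abs_sum_le_sum_abs _ _).trans (Finset.sum_le_sum fun k _ => ?_)
    rw [mul_assoc, abs_mul]
    gcongr
    rw [abs_of_nonneg (by positivity), Real.exp_neg, ← div_eq_mul_inv,
      div_le_iff₀ (Real.exp_pos _)]
    have := Real.pow_div_factorial_le_exp _ hs.le k
    rwa [div_le_iff₀ (by positivity), mul_comm] at this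

/-! ### A compactly supported Gevrey bump. -/

theorem factorial_mul_factorial_sub_le {i j : ℕ} (h : j ≤ i) :
    ((2 * j).factorial : ℝ) * ((2 * (i - j)).factorial : ℝ) ≤ ((2 * i).factorial : ℝ) := by
  have := Nat.factorial_mul_factorial_dvd_factorial_add (2 * j) (2 * (i - j))
  rw [show 2 * j + 2 * (i - j) = 2 * i by omega] at this
  exact_mod_cast Nat.le_of_dvd (Nat.factorial_pos _) this

/-- A smooth bump on `(0,τ)` with Gevrey-type derivative bounds. -/
def gevreyBump (τ t : ℝ) : ℝ := expNegInvGlue (8⁻¹ * t) * expNegInvGlue (8⁻¹ * (τ - t))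

theorem contDiff_gevreyBump (τ : ℝ) (n : ℕ∞) : ContDiff ℝ n (gevreyBump τ) := by
  unfold gevreyBump
  exact (expNegInvGlue.contDiff.comp (by fun_prop)).mul
    (expNegInvGlue.contDiff.comp (by fun_prop))

theorem hasDerivAt_iteratedDeriv_gevreyBump (τ : ℝ) (i : ℕ) (t : ℝ) :
    HasDerivAt (iteratedDeriv i (gevreyBump τ)) (iteratedDeriv (i + 1) (gevreyBump τ) t) t := by
  rw [iteratedDeriv_succ]
  refine DifferentiableAt.hasDerivAt ?_
  exact ((contDiff_gevreyBump τ ⊤).differentiable_iteratedDeriv i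
    (by exact_mod_cast WithTop.coe_lt_top _)) t

theorem continuous_iteratedDeriv_gevreyBump (τ : ℝ) (i : ℕ) :
    Continuous (iteratedDeriv i (gevreyBump τ)) :=
  continuous_iff_continuousAt.2 fun t =>
    (hasDerivAt_iteratedDeriv_gevreyBump τ i t).continuousAt

theorem gevreyBump_nonneg (τ t : ℝ) : 0 ≤ gevreyBump τ t :=
  mul_nonneg (expNegInvGlue.nonneg _) (expNegInvGlue.nonneg _)

theorem gevreyBump_pos {τ t : ℝ} (h : t ∈ Ioo 0 τ) : 0 < gevreyBump τ t :=
  mul_pos (expNegInvGlue.pos_of_pos (by have := h.1; positivity))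
    (expNegInvGlue.pos_of_pos (by have := sub_pos.2 h.2; positivity))

/-- One-sided derivatives inside the closed half-lines give the endpoints 0 and τ as well; these
kill the boundary terms when integrating by parts. -/
theorem iteratedDeriv_gevreyBump_eq_zero {τ : ℝ} (i : ℕ) :
    (∀ t ≤ 0, iteratedDeriv i (gevreyBump τ) t = 0) ∧
      ∀ t, τ ≤ t → iteratedDeriv i (gevreyBump τ) t = 0 := by
  induction i with
  | zero =>
    refine ⟨fun t ht => ?_, fun t ht => ?_⟩
    · rw [iteratedDeriv_zero, gevreyBump, expNegInvGlue.zero_of_nonpos (by linarith), zero_mul]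
    · rw [iteratedDeriv_zero, gevreyBump,
        expNegInvGlue.zero_of_nonpos (x := 8⁻¹ * (τ - t)) (by linarith), mul_zero]
  | succ i ih =>
    refine ⟨fun t ht => ?_, fun t ht => ?_⟩
    · have h1 := (hasDerivAt_iteratedDeriv_gevreyBump τ i t).hasDerivWithinAt (s := Iic t)
      have h2 : HasDerivWithinAt (iteratedDeriv i (gevreyBump τ)) 0 (Iic t) t :=
        (hasDerivWithinAt_const t (Iic t) (0 : ℝ)).congr
          (fun x hx => ih.1 x (le_trans hx ht)) (ih.1 t ht)
      exact (uniqueDiffWithinAt_Iic t).eq_deriv _ h1 h2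
    · have h1 := (hasDerivAt_iteratedDeriv_gevreyBump τ i t).hasDerivWithinAt (s := Ici t)
      have h2 : HasDerivWithinAt (iteratedDeriv i (gevreyBump τ)) 0 (Ici t) t :=
        (hasDerivWithinAt_const t (Ici t) (0 : ℝ)).congr
          (fun x hx => ih.2 x (le_trans ht hx)) (ih.2 t ht)
      exact (uniqueDiffWithinAt_Ici t).eq_deriv _ h1 h2

/-- The dilation by 1/8 turns the factor 2^i of each `expNegInvGlue` into 4^{-i}; the Leibniz rule
costs 2^i, and 2^{-i} is left. The bound does not depend on τ. -/
theorem abs_iteratedDeriv_gevreyBump_le (τ : ℝ) (i : ℕ) (t : ℝ) :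
    |iteratedDeriv i (gevreyBump τ) t| ≤ ((2 * i).factorial : ℝ) / 2 ^ i := by
  have hA : ContDiff ℝ i fun t : ℝ => expNegInvGlue (8⁻¹ * t) :=
    expNegInvGlue.contDiff.comp (by fun_prop)
  have hB : ContDiff ℝ i fun t : ℝ => expNegInvGlue (8⁻¹ * (τ - t)) :=
    expNegInvGlue.contDiff.comp (by fun_prop)
  have hcA : ∀ j x, |iteratedDeriv j (fun t : ℝ => expNegInvGlue (8⁻¹ * t)) x|
      ≤ ((2 * j).factorial : ℝ) / 4 ^ j := by
    intro j x
    rw [iteratedDeriv_comp_const_mul expNegInvGlue.contDiff]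
    dsimp only
    rw [abs_mul, abs_of_nonneg (by positivity : (0 : ℝ) ≤ 8⁻¹ ^ j)]
    calc _ ≤ (8⁻¹ : ℝ) ^ j * (2 ^ j * ((2 * j).factorial : ℝ)) := by
          gcongr; exact abs_iteratedDeriv_expNegInvGlue_le j _
      _ = (8⁻¹ * 2 : ℝ) ^ j * ((2 * j).factorial : ℝ) := by rw [mul_pow]; ring
      _ = _ := by rw [show (8⁻¹ * 2 : ℝ) = 4⁻¹ by norm_num, inv_pow]; ring
  have hcB : ∀ j x, |iteratedDeriv j (fun t : ℝ => expNegInvGlue (8⁻¹ * (τ - t))) x|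
      ≤ ((2 * j).factorial : ℝ) / 4 ^ j := by
    intro j x
    have := congrFun (iteratedDeriv_comp_const_sub j (fun t : ℝ => expNegInvGlue (8⁻¹ * t)) τ) x
    rw [this, smul_eq_mul, abs_mul, abs_pow, abs_neg, abs_one, one_pow, one_mul]
    exact hcA j _
  unfold gevreyBump
  have hmul := iteratedDeriv_mul (x := t) hA.contDiffAt hB.contDiffAt
  rw [Pi.mul_def] at hmul
  rw [hmul]
  calc _ ≤ ∑ j ∈ Finset.range (i + 1), (i.choose j : ℝ) * (((2 * i).factorial : ℝ) / 4 ^ i) := by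
        refine (Finset.abs_sum_le_sum_abs _ _).trans (Finset.sum_le_sum fun j hj => ?_)
        have hj' : j ≤ i := Nat.lt_succ_iff.mp (Finset.mem_range.mp hj)
        rw [mul_assoc, abs_mul, Nat.abs_cast, abs_mul]
        gcongr
        calc _ ≤ ((2 * j).factorial : ℝ) / 4 ^ j * (((2 * (i - j)).factorial : ℝ) / 4 ^ (i - j)) :=
              mul_le_mul (hcA j t) (hcB (i - j) t) (abs_nonneg _) (by positivity)
          _ = ((2 * j).factorial : ℝ) * ((2 * (i - j)).factorial : ℝ) / 4 ^ i := by
              rw [div_mul_div_comm, ← pow_add, Nat.add_sub_cancel' hj']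
          _ ≤ _ := by gcongr; exact factorial_mul_factorial_sub_le hj'
    _ = 2 ^ i * (((2 * i).factorial : ℝ) / 4 ^ i) := by
        rw [← Finset.sum_mul]
        congr 1
        exact_mod_cast Nat.sum_range_choose i
    _ = _ := by
        rw [show (4 : ℝ) = 2 * 2 by norm_num, mul_pow]
        field_simp

/-! ### The flat trace and its Laplace transform. -/

theorem hasSum_intervalIntegral_tsum_mul {ι : Type*} [Countable ι] {F : ι → ℝ → ℝ} {M : ι → ℝ}
    (hF : ∀ i, Continuous (F i)) (hM : Summable M) (hFM : ∀ i t, |F i t| ≤ M i)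
    {w : ℝ → ℝ} (hw : Continuous w) (a b : ℝ) :
    HasSum (fun i => ∫ t in a..b, F i t * w t) (∫ t in a..b, (∑' i, F i t) * w t) := by
  refine intervalIntegral.hasSum_integral_of_dominated_convergence (fun i t => M i * |w t|)
    (fun i => ((hF i).mul hw).aestronglyMeasurable) (fun i => ?_) ?_ ?_ ?_
  · refine Filter.Eventually.of_forall fun t _ => ?_
    rw [Real.norm_eq_abs, abs_mul]
    exact mul_le_mul_of_nonneg_right (hFM i t) (abs_nonneg _)
  · exact Filter.Eventually.of_forall fun t _ => hM.mul_right _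
  · simp_rw [tsum_mul_right]
    exact (continuous_const.mul hw.abs).intervalIntegrable _ _
  · exact Filter.Eventually.of_forall fun t _ =>
      (Summable.of_norm_bounded (f := fun i => F i t) hM fun i => hFM i t).hasSum.mul_right (w t)

/-- The terms of the flat boundary trace `∑ (-1)^i φ^(i) / (2i+1)!`. -/
def flatTerm (τ : ℝ) (i : ℕ) (t : ℝ) : ℝ :=
  (-1) ^ i / ((2 * i + 1).factorial : ℝ) * iteratedDeriv i (gevreyBump τ) t

/-- The flat boundary trace, whose Laplace transform is that of the bump times `sin √μ / √μ`. -/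
def flatTrace (τ t : ℝ) : ℝ := ∑' i, flatTerm τ i t

theorem abs_flatTerm_le (τ : ℝ) (i : ℕ) (t : ℝ) : |flatTerm τ i t| ≤ (1 / 2) ^ i := by
  rw [flatTerm, abs_mul, abs_div, abs_pow, abs_neg, abs_one, one_pow, Nat.abs_cast]
  have h1 : ((2 * i).factorial : ℝ) ≤ ((2 * i + 1).factorial : ℝ) := by
    exact_mod_cast Nat.factorial_le (by omega)
  have h0 : (0 : ℝ) < ((2 * i + 1).factorial : ℝ) := by positivity
  calc _ ≤ 1 / ((2 * i + 1).factorial : ℝ) * (((2 * i).factorial : ℝ) / 2 ^ i) := by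
        gcongr; exact abs_iteratedDeriv_gevreyBump_le τ i t
    _ ≤ 1 / ((2 * i + 1).factorial : ℝ) * (((2 * i + 1).factorial : ℝ) / 2 ^ i) := by gcongr
    _ = _ := by rw [one_div_pow]; field_simp

theorem continuous_flatTerm (τ : ℝ) (i : ℕ) : Continuous (flatTerm τ i) :=
  continuous_const.mul (continuous_iteratedDeriv_gevreyBump τ i)

theorem continuous_flatTrace (τ : ℝ) : Continuous (flatTrace τ) :=
  continuous_tsum (continuous_flatTerm τ) summable_geometric_two (abs_flatTerm_le τ)

theorem abs_flatTrace_le (τ t : ℝ) : |flatTrace τ t| ≤ 2 :=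
  tsum_of_norm_bounded (f := fun i => flatTerm τ i t) hasSum_geometric_two
    fun i => abs_flatTerm_le τ i t

theorem flatTrace_of_nonpos (τ : ℝ) {t : ℝ} (ht : t ≤ 0) : flatTrace τ t = 0 := by
  simp [flatTrace, flatTerm, (iteratedDeriv_gevreyBump_eq_zero (τ := τ) _).1 t ht]

theorem flatTrace_of_ge {τ t : ℝ} (ht : τ ≤ t) : flatTrace τ t = 0 := by
  simp [flatTrace, flatTerm, (iteratedDeriv_gevreyBump_eq_zero (τ := τ) _).2 t ht]

theorem integral_iteratedDeriv_succ_gevreyBump_mul (τ : ℝ) (i : ℕ) {w w' : ℝ → ℝ}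
    (hw : ∀ t, HasDerivAt w (w' t) t) (hw' : Continuous w') :
    ∫ t in (0 : ℝ)..τ, iteratedDeriv (i + 1) (gevreyBump τ) t * w t
      = -∫ t in (0 : ℝ)..τ, iteratedDeriv i (gevreyBump τ) t * w' t := by
  have hwc : Continuous w := continuous_iff_continuousAt.2 fun t => (hw t).continuousAt
  have h1 := continuous_iteratedDeriv_gevreyBump τ (i + 1)
  have h0 := continuous_iteratedDeriv_gevreyBump τ i
  have := intervalIntegral.integral_eq_sub_of_hasDerivAt (a := 0) (b := τ)
    (fun t _ => (hasDerivAt_iteratedDeriv_gevreyBump τ i t).mul (hw t))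
    (((h1.mul hwc).add (h0.mul hw')).intervalIntegrable _ _)
  have hadd := intervalIntegral.integral_add (μ := volume) ((h1.mul hwc).intervalIntegrable 0 τ)
    ((h0.mul hw').intervalIntegrable 0 τ)
  simp only [Pi.mul_apply, (iteratedDeriv_gevreyBump_eq_zero (τ := τ) i).1 0 le_rfl,
    (iteratedDeriv_gevreyBump_eq_zero (τ := τ) i).2 τ le_rfl, zero_mul, sub_zero] at this hadd
  linarith

/-- The Laplace transform of the bump. -/
def bumpLaplace (τ μ : ℝ) : ℝ := ∫ t in (0 : ℝ)..τ, gevreyBump τ t * Real.exp (-μ * t)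

theorem hasDerivAt_exp_mul (μ t : ℝ) :
    HasDerivAt (fun t => Real.exp (μ * t)) (μ * Real.exp (μ * t)) t := by
  have := ((hasDerivAt_id t).const_mul μ).exp
  simpa [mul_comm] using this

theorem integral_iteratedDeriv_gevreyBump_mul_exp (τ μ : ℝ) (i : ℕ) :
    ∫ t in (0 : ℝ)..τ, iteratedDeriv i (gevreyBump τ) t * Real.exp (-μ * t)
      = μ ^ i * bumpLaplace τ μ := by
  induction i with
  | zero => simp [bumpLaplace]
  | succ i ih =>
    rw [integral_iteratedDeriv_succ_gevreyBump_mul τ i (hasDerivAt_exp_mul (-μ)) (by fun_prop),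
      pow_succ, mul_right_comm, ← ih, ← intervalIntegral.integral_mul_const,
      ← intervalIntegral.integral_neg]
    exact intervalIntegral.integral_congr fun t _ => by ring

/-- This is minus μ times the μ-derivative of μ^i Φ(μ); the prefactor μ avoids the exponent i - 1.
-/
theorem mul_integral_iteratedDeriv_gevreyBump_mul_id_mul_exp (τ μ : ℝ) (i : ℕ) :
    μ * ∫ t in (0 : ℝ)..τ, iteratedDeriv i (gevreyBump τ) t * (t * Real.exp (-μ * t))
      = μ ^ (i + 1) * (∫ t in (0 : ℝ)..τ, gevreyBump τ t * (t * Real.exp (-μ * t)))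
        - i * μ ^ i * bumpLaplace τ μ := by
  induction i with
  | zero => simp
  | succ i ih =>
    have hw : ∀ t, HasDerivAt (fun t => t * Real.exp (-μ * t))
        (1 * Real.exp (-μ * t) + t * (-μ * Real.exp (-μ * t))) t := fun t =>
      (hasDerivAt_id t).mul (hasDerivAt_exp_mul (-μ) t)
    have hc := continuous_iteratedDeriv_gevreyBump τ i
    have key : ∫ t in (0 : ℝ)..τ, iteratedDeriv i (gevreyBump τ) t *
          (1 * Real.exp (-μ * t) + t * (-μ * Real.exp (-μ * t)))
        = μ ^ i * bumpLaplace τ μ - μ *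
          ∫ t in (0 : ℝ)..τ, iteratedDeriv i (gevreyBump τ) t * (t * Real.exp (-μ * t)) := by
      rw [← integral_iteratedDeriv_gevreyBump_mul_exp, ← intervalIntegral.integral_const_mul,
        ← intervalIntegral.integral_sub
          (Continuous.intervalIntegrable (by fun_prop) _ _)
          (Continuous.intervalIntegrable (by fun_prop) _ _)]
      exact intervalIntegral.integral_congr fun t _ => by ring
    rw [integral_iteratedDeriv_succ_gevreyBump_mul τ i hw (by fun_prop), key, ih]
    push_cast
    ring

theorem hasSum_integral_flatTrace_mul (τ : ℝ) {w : ℝ → ℝ} (hw : Continuous w) :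
    HasSum (fun i : ℕ => (-1) ^ i / ((2 * i + 1).factorial : ℝ) *
      ∫ t in (0 : ℝ)..τ, iteratedDeriv i (gevreyBump τ) t * w t)
      (∫ t in (0 : ℝ)..τ, flatTrace τ t * w t) := by
  have := hasSum_intervalIntegral_tsum_mul (continuous_flatTerm τ) summable_geometric_two
    (abs_flatTerm_le τ) hw 0 τ
  refine this.congr_fun fun i => ?_
  rw [← intervalIntegral.integral_const_mul]
  exact intervalIntegral.integral_congr fun t _ => by simp only [flatTerm]; ring

/-- Termwise integration by parts produces the power series of sin m. -/
theorem mul_integral_flatTrace_mul_exp (τ m : ℝ) :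
    m * ∫ t in (0 : ℝ)..τ, flatTrace τ t * Real.exp (-m ^ 2 * t)
      = Real.sin m * bumpLaplace τ (m ^ 2) := by
  have h := (hasSum_integral_flatTrace_mul τ
    (w := fun t => Real.exp (-m ^ 2 * t)) (by fun_prop)).mul_left m
  refine h.unique ?_
  refine ((Real.hasSum_sin m).mul_right (bumpLaplace τ (m ^ 2))).congr_fun fun i => ?_
  rw [integral_iteratedDeriv_gevreyBump_mul_exp]
  ring

/-- The integral is minus the derivative of Φ(μ) sin √μ / √μ at μ = m². At a zero of the sine only
the term in cos m survives. -/
theorem sq_mul_integral_flatTrace_mul_id_mul_exp (τ : ℝ) {m : ℝ} (hm0 : m ≠ 0)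
    (hm : Real.sin m = 0) :
    m ^ 2 * ∫ t in (0 : ℝ)..τ, flatTrace τ t * (t * Real.exp (-m ^ 2 * t))
      = -(Real.cos m * bumpLaplace τ (m ^ 2) / 2) := by
  set J := ∫ t in (0 : ℝ)..τ, gevreyBump τ t * (t * Real.exp (-m ^ 2 * t)) with hJ
  set Φ := bumpLaplace τ (m ^ 2) with hΦ
  have h := (hasSum_integral_flatTrace_mul τ
    (w := fun t => t * Real.exp (-m ^ 2 * t)) (by fun_prop)).mul_left (m ^ 2)
  -- Writing i = ((2i+1) - 1)/2 splits ∑ (-1)^i i m^{2i}/(2i+1)! into (cos m - sin m / m)/2.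
  have h2 := ((Real.hasSum_sin m).mul_right (m * J + Φ / (2 * m))).sub
    ((Real.hasSum_cos m).mul_right (Φ / 2))
  rw [hm] at h2
  refine h.unique ?_
  rw [show -(Real.cos m * Φ / 2) = 0 * (m * J + Φ / (2 * m)) - Real.cos m * (Φ / 2) by ring]
  refine h2.congr_fun fun i => ?_
  rw [mul_left_comm, mul_integral_iteratedDeriv_gevreyBump_mul_id_mul_exp, ← hJ, ← hΦ,
    Nat.factorial_succ (2 * i)]
  have hf : ((2 * i).factorial : ℝ) ≠ 0 := by positivity
  push_cast
  have hi : (2 * (i : ℝ) + 1) ≠ 0 := by positivity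
  field_simp
  ring

/-! ### The biorthogonal family. -/

theorem eigenvalue_pos (n : ℕ+) : 0 < eigenvalue n := by
  have : (0 : ℝ) < n := by exact_mod_cast n.pos
  have := Real.pi_pos
  unfold eigenvalue; positivity

theorem eigenvalue_eq_sq (n : ℕ+) : eigenvalue n = (Real.pi * n) ^ 2 := by
  rw [eigenvalue, mul_pow]

theorem eigenvalue_injective : Function.Injective eigenvalue := by
  intro n k h
  have hn : (0 : ℝ) ≤ n := by positivity
  have hk : (0 : ℝ) ≤ k := by positivity
  rw [eigenvalue, eigenvalue, mul_right_inj' (by positivity), sq_eq_sq₀ hn hk] at h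
  exact_mod_cast h

theorem pi_mul_pnat_ne_zero (n : ℕ+) : Real.pi * (n : ℝ) ≠ 0 :=
  mul_ne_zero Real.pi_ne_zero (by exact_mod_cast n.ne_zero)

theorem sin_pi_mul_pnat (n : ℕ+) : Real.sin (Real.pi * n) = 0 := by
  rw [mul_comm]; exact_mod_cast Real.sin_nat_mul_pi (n : ℕ)

theorem cos_pi_mul_pnat (n : ℕ+) : Real.cos (Real.pi * n) = (-1) ^ (n : ℕ) := by
  rw [mul_comm]; exact_mod_cast Real.cos_nat_mul_pi (n : ℕ)

theorem integral_flatTrace_mul_exp (τ : ℝ) (n : ℕ+) :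
    ∫ t in (0 : ℝ)..τ, flatTrace τ t * Real.exp (-eigenvalue n * t) = 0 := by
  have := mul_integral_flatTrace_mul_exp τ (Real.pi * n)
  rw [sin_pi_mul_pnat, zero_mul, ← eigenvalue_eq_sq] at this
  exact (mul_eq_zero.1 this).resolve_left (pi_mul_pnat_ne_zero n)

theorem integral_flatTrace_mul_id_mul_exp (τ : ℝ) (n : ℕ+) :
    ∫ t in (0 : ℝ)..τ, flatTrace τ t * (t * Real.exp (-eigenvalue n * t))
      = -((-1) ^ (n : ℕ) * bumpLaplace τ (eigenvalue n) / (2 * eigenvalue n)) := by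
  have := sq_mul_integral_flatTrace_mul_id_mul_exp τ (pi_mul_pnat_ne_zero n) (sin_pi_mul_pnat n)
  rw [cos_pi_mul_pnat, ← eigenvalue_eq_sq] at this
  have h0 := (eigenvalue_pos n).ne'
  rw [eq_comm, ← mul_right_inj' h0, this]
  field_simp

/-- The primitive of the flat trace against `e^{-λₙ t}`. -/
def flatPrimitive (τ : ℝ) (n : ℕ+) (t : ℝ) : ℝ :=
  ∫ s in (0 : ℝ)..t, flatTrace τ s * Real.exp (-eigenvalue n * s)

theorem hasDerivAt_flatPrimitive (τ : ℝ) (n : ℕ+) (t : ℝ) :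
    HasDerivAt (flatPrimitive τ n) (flatTrace τ t * Real.exp (-eigenvalue n * t)) t :=
  (((continuous_flatTrace τ).mul (by fun_prop :
    Continuous fun s => Real.exp (-eigenvalue n * s))).integral_hasStrictDerivAt 0 t).hasDerivAt

theorem continuous_flatPrimitive (τ : ℝ) (n : ℕ+) : Continuous (flatPrimitive τ n) :=
  continuous_iff_continuousAt.2 fun t => (hasDerivAt_flatPrimitive τ n t).continuousAt

theorem flatPrimitive_of_nonpos (τ : ℝ) (n : ℕ+) {t : ℝ} (ht : t ≤ 0) :
    flatPrimitive τ n t = 0 := by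
  rw [flatPrimitive, intervalIntegral.integral_congr (g := fun _ => 0),
    intervalIntegral.integral_zero]
  intro s hs
  rw [uIcc_of_ge ht] at hs
  simp [flatTrace_of_nonpos τ hs.2]

theorem flatPrimitive_of_ge {τ : ℝ} (n : ℕ+) {t : ℝ} (ht : τ ≤ t) :
    flatPrimitive τ n t = 0 := by
  have hc : Continuous fun s => flatTrace τ s * Real.exp (-eigenvalue n * s) :=
    (continuous_flatTrace τ).mul (by fun_prop)
  rw [flatPrimitive, ← intervalIntegral.integral_add_adjacent_intervals
    (hc.intervalIntegrable 0 τ) (hc.intervalIntegrable τ t), integral_flatTrace_mul_exp, zero_add,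
    intervalIntegral.integral_congr (g := fun _ => 0), intervalIntegral.integral_zero]
  intro s hs
  rw [uIcc_of_le ht] at hs
  simp [flatTrace_of_ge hs.1]

theorem abs_flatPrimitive_le (τ : ℝ) (n : ℕ+) {t : ℝ} (ht : 0 ≤ t) :
    |flatPrimitive τ n t| ≤ 2 * t := by
  have := intervalIntegral.norm_integral_le_of_norm_le_const (a := 0) (b := t) (C := 2)
    (f := fun s => flatTrace τ s * Real.exp (-eigenvalue n * s)) fun s hs => by
      rw [uIoc_of_le ht] at hs
      rw [Real.norm_eq_abs, abs_mul, Real.abs_exp]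
      have h1 : Real.exp (-eigenvalue n * s) ≤ 1 := Real.exp_le_one_iff.2
        (by nlinarith [eigenvalue_pos n, hs.1])
      calc _ ≤ (2 : ℝ) * 1 :=
            mul_le_mul (abs_flatTrace_le τ s) h1 (Real.exp_nonneg _) (by norm_num)
        _ = 2 := by norm_num
  rwa [sub_zero, abs_of_nonneg ht] at this

/-- Integrate the derivative of e^{(λ_n-λ_k)t} times the primitive over (0,τ): the boundary terms
vanish, and the flat trace is orthogonal to e^{-λ_k t}. -/
theorem integral_exp_mul_flatPrimitive_of_ne (τ : ℝ) {n k : ℕ+} (h : n ≠ k) :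
    ∫ t in (0 : ℝ)..τ, Real.exp (eigenvalue n * t) * flatPrimitive τ n t *
      Real.exp (-eigenvalue k * t) = 0 := by
  set c := eigenvalue n - eigenvalue k with hc
  have hc0 : c ≠ 0 := sub_ne_zero.2 fun h' => h (eigenvalue_injective h')
  have hder : ∀ t, HasDerivAt (fun t => Real.exp (c * t) * flatPrimitive τ n t)
      (c * (Real.exp (eigenvalue n * t) * flatPrimitive τ n t * Real.exp (-eigenvalue k * t))
        + flatTrace τ t * Real.exp (-eigenvalue k * t)) t := by
    intro t
    refine ((hasDerivAt_exp_mul c t).mul (hasDerivAt_flatPrimitive τ n t)).congr_deriv ?_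
    have h1 : Real.exp (c * t) = Real.exp (eigenvalue n * t) * Real.exp (-eigenvalue k * t) := by
      rw [← Real.exp_add]; congr 1; rw [hc]; ring
    have h2 : Real.exp (c * t) * Real.exp (-eigenvalue n * t) = Real.exp (-eigenvalue k * t) := by
      rw [← Real.exp_add]; congr 1; rw [hc]; ring
    linear_combination c * flatPrimitive τ n t * h1 + flatTrace τ t * h2
  have hcont1 : Continuous fun t => Real.exp (eigenvalue n * t) * flatPrimitive τ n t *
      Real.exp (-eigenvalue k * t) :=
    ((by fun_prop : Continuous fun t => Real.exp (eigenvalue n * t)).mul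
      (continuous_flatPrimitive τ n)).mul (by fun_prop)
  have hcont2 : Continuous fun t => flatTrace τ t * Real.exp (-eigenvalue k * t) :=
    (continuous_flatTrace τ).mul (by fun_prop)
  have := intervalIntegral.integral_eq_sub_of_hasDerivAt (a := 0) (b := τ) (fun t _ => hder t)
    (((hcont1.intervalIntegrable 0 τ).const_mul c).add (hcont2.intervalIntegrable 0 τ))
  rw [intervalIntegral.integral_add ((hcont1.intervalIntegrable 0 τ).const_mul c)
    (hcont2.intervalIntegrable _ _), integral_flatTrace_mul_exp,
    intervalIntegral.integral_const_mul, flatPrimitive_of_ge n le_rfl,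
    flatPrimitive_of_nonpos τ n le_rfl] at this
  simpa [hc0] using this

/-- The exponentials cancel, and integrating the bare primitive by parts against 1 yields minus the
first moment of the flat trace. -/
theorem integral_exp_mul_flatPrimitive_self (τ : ℝ) (n : ℕ+) :
    ∫ t in (0 : ℝ)..τ, Real.exp (eigenvalue n * t) * flatPrimitive τ n t *
      Real.exp (-eigenvalue n * t)
      = (-1) ^ (n : ℕ) * bumpLaplace τ (eigenvalue n) / (2 * eigenvalue n) := by
  have hder : ∀ t, HasDerivAt (fun t => t * flatPrimitive τ n t)
      (flatPrimitive τ n t + flatTrace τ t * (t * Real.exp (-eigenvalue n * t))) t := by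
    intro t
    refine ((hasDerivAt_id t).mul (hasDerivAt_flatPrimitive τ n t)).congr_deriv ?_
    rw [id, one_mul]
    ring
  have hcont : Continuous fun t => flatTrace τ t * (t * Real.exp (-eigenvalue n * t)) :=
    (continuous_flatTrace τ).mul (by fun_prop)
  have := intervalIntegral.integral_eq_sub_of_hasDerivAt (a := 0) (b := τ) (fun t _ => hder t)
    (((continuous_flatPrimitive τ n).add hcont).intervalIntegrable _ _)
  rw [intervalIntegral.integral_add ((continuous_flatPrimitive τ n).intervalIntegrable _ _)
    (hcont.intervalIntegrable _ _), integral_flatTrace_mul_id_mul_exp,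
    flatPrimitive_of_ge n le_rfl, zero_mul, mul_zero, sub_zero] at this
  rw [add_neg_eq_zero] at this
  rw [← this]
  refine intervalIntegral.integral_congr fun t _ => ?_
  rw [mul_right_comm, ← Real.exp_add]
  simp

theorem integral_gevreyBump_pos {τ : ℝ} (hτ : 0 < τ) :
    0 < ∫ t in (0 : ℝ)..τ, gevreyBump τ t :=
  intervalIntegral.intervalIntegral_pos_of_pos_on
    ((contDiff_gevreyBump τ 0).continuous.intervalIntegrable _ _)
    (fun _ ht => gevreyBump_pos ht) hτ

theorem exp_mul_integral_gevreyBump_le {τ μ : ℝ} (hτ : 0 < τ) (hμ : 0 ≤ μ) :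
    Real.exp (-μ * τ) * (∫ t in (0 : ℝ)..τ, gevreyBump τ t) ≤ bumpLaplace τ μ := by
  have hc := (contDiff_gevreyBump τ 0).continuous
  rw [bumpLaplace, mul_comm, ← intervalIntegral.integral_mul_const]
  refine intervalIntegral.integral_mono_on hτ.le
    ((hc.mul continuous_const).intervalIntegrable _ _)
    ((hc.mul (by fun_prop)).intervalIntegrable _ _) fun t ht => ?_
  refine mul_le_mul_of_nonneg_left (Real.exp_le_exp.2 ?_) (gevreyBump_nonneg _ _)
  nlinarith [ht.2]

/-- A family biorthogonal to the exponentials `e^{-λₙ t}` on `(0,τ)`, of exponential size with an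
arbitrarily small rate. -/
theorem exists_biorthogonal {τ : ℝ} (hτ : 0 < τ) :
    ∃ (q : ℕ+ → ℝ → ℝ) (K : ℝ), 0 < K ∧ (∀ n, Continuous (q n)) ∧
      (∀ n t, τ ≤ t → q n t = 0) ∧
      (∀ n t, |q n t| ≤ K * Real.exp (3 * τ * eigenvalue n)) ∧
      ∀ n k, ∫ t in (0 : ℝ)..τ, q n t * Real.exp (-eigenvalue k * t) = if n = k then 1 else 0 := by
  set P := ∫ t in (0 : ℝ)..τ, gevreyBump τ t with hP
  have hP0 : 0 < P := integral_gevreyBump_pos hτ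
  have hΦ : ∀ n, 0 < bumpLaplace τ (eigenvalue n) := fun n =>
    (mul_pos (Real.exp_pos _) hP0).trans_le
      (exp_mul_integral_gevreyBump_le hτ (eigenvalue_pos n).le)
  -- The inverse of the diagonal pairing, as (-1)^n is its own inverse.
  set c : ℕ+ → ℝ := fun n => (-1) ^ (n : ℕ) * (2 * eigenvalue n) / bumpLaplace τ (eigenvalue n)
    with hc
  refine ⟨fun n t => c n * (Real.exp (eigenvalue n * t) * flatPrimitive τ n t), 4 / P,
    by positivity, fun n => ?_, fun n t ht => ?_, fun n t => ?_, fun n k => ?_⟩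
  · exact continuous_const.mul ((by fun_prop : Continuous fun t => Real.exp (eigenvalue n * t)).mul
      (continuous_flatPrimitive τ n))
  · simp [flatPrimitive_of_ge n ht]
  · have hK : 0 ≤ 4 / P * Real.exp (3 * τ * eigenvalue n) := by positivity
    rcases le_or_gt t 0 with h0 | h0
    · simpa [flatPrimitive_of_nonpos τ n h0] using hK
    rcases le_or_gt τ t with h1 | h1
    · simpa [flatPrimitive_of_ge n h1] using hK
    have hμ := eigenvalue_pos n
    set μ := eigenvalue n with hμd
    -- Of the rate 3τ, one τ comes from 1/Φ(μ), one from the factor e^{μt}, and one absorbs the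
    -- linear factor μτ here.
    have e1 : μ * τ ≤ Real.exp (μ * τ) := by linarith [Real.add_one_le_exp (μ * τ)]
    have hcn : |c n| ≤ 2 * μ / (Real.exp (-μ * τ) * P) := by
      rw [hc]
      simp only
      rw [abs_div, abs_mul, abs_pow, abs_neg, abs_one, one_pow, one_mul,
        abs_of_pos (hΦ n), abs_of_pos (by positivity)]
      have := exp_mul_integral_gevreyBump_le hτ hμ.le
      gcongr
    rw [abs_mul, abs_mul, Real.abs_exp]
    calc _ ≤ 2 * μ / (Real.exp (-μ * τ) * P) * (Real.exp (μ * τ) * (2 * τ)) := by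
          gcongr
          exact (abs_flatPrimitive_le τ n h0.le).trans (by linarith)
      _ = 4 / P * ((μ * τ) * Real.exp (μ * τ) * Real.exp (μ * τ)) := by
          rw [neg_mul, Real.exp_neg]
          field_simp
          ring
      _ ≤ 4 / P * (Real.exp (μ * τ) * Real.exp (μ * τ) * Real.exp (μ * τ)) := by gcongr
      _ = _ := by rw [← Real.exp_add, ← Real.exp_add]; congr 2; ring
  · simp_rw [mul_assoc (c n)]
    rw [intervalIntegral.integral_const_mul]
    split_ifs with h
    · subst h
      rw [integral_exp_mul_flatPrimitive_self, hc]
      have h1 := (hΦ n).ne'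
      have h2 := (eigenvalue_pos n).ne'
      have h3 : ((-1 : ℝ) ^ (n : ℕ)) * (-1) ^ (n : ℕ) = 1 := by
        rw [← mul_pow]; simp
      field_simp
      rw [sq, h3]
    · rw [integral_exp_mul_flatPrimitive_of_ne τ h, mul_zero]

/-! ### Summability and the moment problem. -/

theorem one_le_eigenvalue (n : ℕ+) : 1 ≤ eigenvalue n := by
  have hn : (1 : ℝ) ≤ n := by exact_mod_cast one_le
  have hp := Real.pi_gt_three
  rw [eigenvalue_eq_sq]
  nlinarith [mul_le_mul hp.le hn zero_le_one (by linarith)]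

theorem summable_inv_eigenvalue : Summable fun n : ℕ+ => (eigenvalue n)⁻¹ := by
  have h1 : Summable fun n : ℕ => ((n : ℝ) ^ 2)⁻¹ := Real.summable_nat_pow_inv.2 (by norm_num)
  have h2 : Summable fun n : ℕ+ => (((n : ℕ) : ℝ) ^ 2)⁻¹ := h1.comp_injective PNat.coe_injective
  refine (h2.mul_left (Real.pi ^ 2)⁻¹).congr fun n => ?_
  rw [eigenvalue, mul_inv]

theorem exp_neg_eigenvalue_mul_le {t : ℝ} (ht : 0 < t) (n : ℕ+) :
    Real.exp (-eigenvalue n * t) ≤ t⁻¹ * (eigenvalue n)⁻¹ := by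
  have hl := eigenvalue_pos n
  rw [neg_mul, Real.exp_neg, ← mul_inv, mul_comm t]
  exact inv_anti₀ (by positivity) (by linarith [Real.add_one_le_exp (eigenvalue n * t)])

theorem summable_exp_neg_eigenvalue_mul {t : ℝ} (ht : 0 < t) :
    Summable fun n => Real.exp (-eigenvalue n * t) :=
  Summable.of_nonneg_of_le (fun _ => Real.exp_nonneg _) (exp_neg_eigenvalue_mul_le ht)
    (summable_inv_eigenvalue.mul_left _)

/-- Split |f_n|/λ_n as (λ_n^{-s/2} |f_n|) · λ_n^{s/2-1} and use 2xy ≤ x² + y²; the second square is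
λ_n^{s-2} ≤ λ_n⁻¹ because s ≤ 1 and λ_n ≥ 1. -/
theorem NegSobolev.summable_abs_coeff_mul_inv {s : ℝ} (hs : s ≤ 1) (f : NegSobolev s) :
    Summable fun n => |f.coeff n| * (eigenvalue n)⁻¹ := by
  have h := (f.summable_coeff.add summable_inv_eigenvalue)
  refine Summable.of_nonneg_of_le
    (fun n => mul_nonneg (abs_nonneg _) (inv_nonneg.2 (eigenvalue_pos n).le)) (fun n => ?_) h
  have hl := eigenvalue_pos n
  have e1 : (eigenvalue n ^ (-s / 2)) ^ 2 = eigenvalue n ^ (-s) := by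
    rw [← Real.rpow_natCast, ← Real.rpow_mul hl.le]; congr 1; push_cast; ring
  have e2 : (eigenvalue n ^ (s / 2 - 1)) ^ 2 = eigenvalue n ^ (s - 2) := by
    rw [← Real.rpow_natCast, ← Real.rpow_mul hl.le]; congr 1; push_cast; ring
  have e3 : eigenvalue n ^ (-s / 2) * eigenvalue n ^ (s / 2 - 1) = (eigenvalue n)⁻¹ := by
    rw [← Real.rpow_add hl, ← Real.rpow_neg_one]; congr 1; ring
  have e4 : eigenvalue n ^ (s - 2) ≤ (eigenvalue n)⁻¹ := by
    rw [← Real.rpow_neg_one]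
    exact Real.rpow_le_rpow_of_exponent_le (one_le_eigenvalue n) (by linarith)
  have e5 := sq_nonneg (eigenvalue n ^ (-s / 2) * |f.coeff n|)
  have e6 := sq_nonneg (eigenvalue n ^ (s / 2 - 1))
  have e7 := sq_nonneg (eigenvalue n ^ (-s / 2) * |f.coeff n| - eigenvalue n ^ (s / 2 - 1))
  rw [← e1]
  rw [← e3] at e4 ⊢
  nlinarith

/-- Solution of the moment problem for the null control of the diagonal system with input
coefficients `a`, by a continuous control. -/
theorem exists_moment_control {C α T : ℝ} (hC : 0 < C) (hα : 0 < α) (hT : α < T) {a : ℕ+ → ℝ}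
    (ha : ∀ n, C * Real.exp (-α * eigenvalue n) ≤ |a n|) :
    ∃ K : ℝ, 0 < K ∧ ∀ (z : ℕ+ → ℝ) (B : ℝ), (∀ n, |z n| ≤ B) →
      ∃ h : ℝ → ℝ, Continuous h ∧ (∀ r, |h r| ≤ K * B) ∧
        ∀ k, a k * ∫ r in (0 : ℝ)..T, h r * Real.exp (-eigenvalue k * (T - r))
          = -(Real.exp (-eigenvalue k * T) * z k) := by
  -- The n-th term has size e^{-λ_n(T-α-3τ)}; this τ leaves the summable e^{-λ_n τ}.
  obtain ⟨τ, hτ, hτT⟩ : ∃ τ > 0, T - α - 3 * τ = τ :=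
    ⟨(T - α) / 4, by linarith, by ring⟩
  obtain ⟨q, K, hK, hqc, hq0, hqb, hq⟩ := exists_biorthogonal hτ
  have ha0 : ∀ n, a n ≠ 0 := fun n =>
    abs_pos.1 ((mul_pos hC (Real.exp_pos _)).trans_le (ha n))
  set S := ∑' n, Real.exp (-eigenvalue n * τ) with hS
  have hSs := summable_exp_neg_eigenvalue_mul hτ
  have hS0 : 0 ≤ S := tsum_nonneg fun _ => Real.exp_nonneg _
  -- The summand 1 makes positivity immediate from S ≥ 0.
  refine ⟨K / C * S + 1, by positivity, fun z B hz => ?_⟩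
  have hB : 0 ≤ B := (abs_nonneg _).trans (hz 1)
  set F : ℕ+ → ℝ → ℝ := fun n t => -(Real.exp (-eigenvalue n * T) * z n) / a n * q n t with hF
  have hFc : ∀ n, Continuous (F n) := fun n => continuous_const.mul (hqc n)
  have hFb : ∀ n t, |F n t| ≤ K / C * B * Real.exp (-eigenvalue n * τ) := by
    intro n t
    rw [hF]
    simp only
    rw [abs_mul, abs_div, abs_neg, abs_mul, Real.abs_exp]
    calc _ ≤ Real.exp (-eigenvalue n * T) * B / (C * Real.exp (-α * eigenvalue n)) *
          (K * Real.exp (3 * τ * eigenvalue n)) := by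
          gcongr
          · exact hz n
          · exact ha n
          · exact hqb n t
      _ = K / C * B * (Real.exp (-eigenvalue n * T) * Real.exp (α * eigenvalue n) *
          Real.exp (3 * τ * eigenvalue n)) := by
          rw [neg_mul α, Real.exp_neg (α * eigenvalue n)]
          field_simp
      _ = _ := by
          rw [← Real.exp_add, ← Real.exp_add]
          congr 2
          linear_combination (-eigenvalue n) * hτT
  have hMs : Summable fun n => K / C * B * Real.exp (-eigenvalue n * τ) := hSs.mul_left _
  have hgc : Continuous fun t => ∑' n, F n t := continuous_tsum hFc hMs hFb
  refine ⟨fun r => ∑' n, F n (T - r), hgc.comp (by fun_prop), fun r => ?_, fun k => ?_⟩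
  · have := tsum_of_norm_bounded (f := fun n => F n (T - r)) hMs.hasSum fun n => hFb n (T - r)
    rw [Real.norm_eq_abs, tsum_mul_left] at this
    nlinarith
  · have hsub := intervalIntegral.integral_comp_sub_left (a := 0) (b := T)
      (fun t => (∑' n, F n t) * Real.exp (-eigenvalue k * t)) T
    rw [sub_self, sub_zero] at hsub
    rw [hsub]
    have hsum := hasSum_intervalIntegral_tsum_mul hFc hMs hFb
      (w := fun t => Real.exp (-eigenvalue k * t)) (by fun_prop) 0 T
    have hterm : ∀ n, ∫ t in (0 : ℝ)..T, F n t * Real.exp (-eigenvalue k * t)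
        = if n = k then -(Real.exp (-eigenvalue k * T) * z k) / a k else 0 := by
      intro n
      have hc : Continuous fun t => q n t * Real.exp (-eigenvalue k * t) :=
        (hqc n).mul (by fun_prop)
      have hz0 : ∫ t in τ..T, q n t * Real.exp (-eigenvalue k * t) = 0 := by
        rw [intervalIntegral.integral_congr (g := fun _ => 0), intervalIntegral.integral_zero]
        intro t ht
        rw [uIcc_of_le (by linarith)] at ht
        simp [hq0 n t ht.1]
      simp_rw [hF, mul_assoc]
      rw [intervalIntegral.integral_const_mul, ← intervalIntegral.integral_add_adjacent_intervals
        (hc.intervalIntegrable 0 τ) (hc.intervalIntegrable τ T), hq, hz0]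
      split_ifs with h
      · rw [h]; ring
      · ring
    simp_rw [hterm] at hsum
    rw [hsum.unique (hasSum_ite_eq k _)]
    field_simp [ha0 k]

/-! ### Orthonormality of the sine functions. -/

theorem inner_e (n k : ℕ+) :
    inner ℝ (e n) (e k) = ∫ x in (0 : ℝ)..1, sineFun n x * sineFun k x := by
  rw [L2.inner_def, intervalIntegral.integral_of_le zero_le_one, integral_Ioc_eq_integral_Ioo]
  refine integral_congr_ae ?_
  filter_upwards [(memLp_sineFun n).coeFn_toLp, (memLp_sineFun k).coeFn_toLp] with x h1 h2
  rw [e, e, h1, h2]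
  simp [mul_comm]

theorem integral_cos_pi_mul_int {m : ℤ} (hm : m ≠ 0) :
    ∫ x in (0 : ℝ)..1, Real.cos (Real.pi * m * x) = 0 := by
  have hc : Real.pi * (m : ℝ) ≠ 0 := mul_ne_zero Real.pi_ne_zero (by exact_mod_cast hm)
  rw [intervalIntegral.integral_comp_mul_left (fun x => Real.cos x) hc, integral_cos]
  simp [mul_comm Real.pi, Real.sin_int_mul_pi]

theorem orthonormal_e : Orthonormal ℝ e := by
  rw [orthonormal_iff_ite]
  intro n k
  have hprod : ∀ x, sineFun n x * sineFun k x
      = Real.cos (Real.pi * ((n - k : ℤ) : ℝ) * x)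
        - Real.cos (Real.pi * ((n + k : ℤ) : ℝ) * x) := by
    intro x
    have h2 : √2 * √2 = (2 : ℝ) := Real.mul_self_sqrt (by norm_num)
    rw [sineFun, sineFun]
    push_cast
    rw [mul_sub, mul_add, sub_mul, add_mul, Real.cos_sub, Real.cos_add]
    linear_combination (Real.sin (Real.pi * n * x) * Real.sin (Real.pi * k * x)) * h2
  have hcc : ∀ m : ℝ, IntervalIntegrable (fun x => Real.cos (m * x)) volume 0 1 := fun m =>
    Continuous.intervalIntegrable (by fun_prop) _ _
  have hpos : ((n : ℤ) + k : ℤ) ≠ 0 := by have := n.pos; positivity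
  rw [inner_e]
  simp_rw [hprod]
  rw [intervalIntegral.integral_sub (hcc _) (hcc _), integral_cos_pi_mul_int hpos, sub_zero]
  split_ifs with h
  · simp [h]
  · refine integral_cos_pi_mul_int (sub_ne_zero.2 fun h' => h ?_)
    exact_mod_cast h'

/-! ### The Duhamel integral, mode by mode. -/

theorem integrable_tsum_of_summable_integral_norm {ι X E : Type*} [Countable ι]
    [MeasurableSpace X] {μ : Measure X} [NormedAddCommGroup E] [NormedSpace ℝ E] [CompleteSpace E]
    {F : ι → X → E} (hF : ∀ i, Integrable (F i) μ) (hsum : Summable fun i => ∫ x, ‖F i x‖ ∂μ) :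
    Integrable (fun x => ∑' i, F i x) μ := by
  -- By Tonelli the sum of the norms has finite integral, so the series converges absolutely almost
  -- everywhere.
  have hfin : ∫⁻ x, ∑' i, ‖F i x‖ₑ ∂μ ≠ ⊤ := by
    rw [lintegral_tsum fun i => (hF i).1.enorm]
    simp_rw [← ofReal_integral_norm_eq_lintegral_enorm (hF _)]
    exact hsum.tsum_ofReal_ne_top
  have hae : ∀ᵐ x ∂μ, Summable fun i => F i x := by
    filter_upwards [ae_lt_top' (AEMeasurable.tsum fun i => (hF i).1.enorm) hfin] with x hx
    refine Summable.of_norm ?_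
    simp_rw [enorm_eq_nnnorm] at hx
    exact NNReal.summable_coe.2 (ENNReal.tsum_coe_ne_top_iff_summable.1 hx.ne)
  refine ⟨?_, ?_⟩
  · refine aestronglyMeasurable_of_tendsto_ae (Filter.atTop : Filter (Finset ι))
      (f := fun s x => ∑ i ∈ s, F i x)
      (fun s => (integrable_finsetSum s fun i _ => hF i).1) ?_
    filter_upwards [hae] with x hx using hx.hasSum
  · refine lt_of_le_of_lt (lintegral_mono fun x => ?_) hfin.lt_top
    exact enorm_tsum_le_tsum_enorm

theorem integral_exp_neg_eigenvalue_mul_sub_le (n : ℕ+) (t : ℝ) :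
    ∫ r in (0 : ℝ)..t, Real.exp (-eigenvalue n * (t - r)) ≤ (eigenvalue n)⁻¹ := by
  have hl := eigenvalue_pos n
  have hder : ∀ r, HasDerivAt (fun r => (eigenvalue n)⁻¹ * Real.exp (-eigenvalue n * (t - r)))
      (Real.exp (-eigenvalue n * (t - r))) r := by
    intro r
    have := ((((hasDerivAt_id r).const_sub t).const_mul (-eigenvalue n)).exp).const_mul
      (eigenvalue n)⁻¹
    refine this.congr_deriv ?_
    simp only [id]
    field_simp
  rw [intervalIntegral.integral_eq_sub_of_hasDerivAt (fun r _ => hder r)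
    (Continuous.intervalIntegrable (by fun_prop) _ _)]
  have : 0 ≤ (eigenvalue n)⁻¹ * Real.exp (-eigenvalue n * (t - 0)) := by positivity
  simp only [sub_self, mul_zero, Real.exp_zero, mul_one]
  linarith

/-- The `n`-th modal convolution `∫₀ᵗ h(r) e^{-λₙ (t-r)} dr`. -/
def modalConv (h : ℝ → ℝ) (n : ℕ+) (t : ℝ) : ℝ :=
  ∫ r in (0 : ℝ)..t, h r * Real.exp (-eigenvalue n * (t - r))

theorem continuous_modalConv {h : ℝ → ℝ} (hh : Continuous h) (n : ℕ+) :
    Continuous (modalConv h n) := by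
  have hc : Continuous fun r => h r * Real.exp (eigenvalue n * r) := hh.mul (by fun_prop)
  have heq : modalConv h n = fun t => Real.exp (-eigenvalue n * t) *
      ∫ r in (0 : ℝ)..t, h r * Real.exp (eigenvalue n * r) := by
    ext t
    rw [modalConv, ← intervalIntegral.integral_const_mul]
    refine intervalIntegral.integral_congr fun r _ => ?_
    rw [mul_left_comm, ← Real.exp_add]
    congr 2
    ring
  rw [heq]
  exact (by fun_prop : Continuous fun t => Real.exp (-eigenvalue n * t)).mul
    (intervalIntegral.continuous_primitive (fun a b => hc.intervalIntegrable a b) 0)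

theorem abs_modalConv_le {h : ℝ → ℝ} (hh : Continuous h) {B : ℝ} (hB : ∀ r, |h r| ≤ B)
    (n : ℕ+) {t : ℝ} (ht : 0 ≤ t) : |modalConv h n t| ≤ B * (eigenvalue n)⁻¹ := by
  have hB0 : 0 ≤ B := (abs_nonneg _).trans (hB 0)
  calc _ ≤ ∫ r in (0 : ℝ)..t, |h r * Real.exp (-eigenvalue n * (t - r))| :=
        intervalIntegral.abs_integral_le_integral_abs ht
    _ ≤ ∫ r in (0 : ℝ)..t, B * Real.exp (-eigenvalue n * (t - r)) := by
        refine intervalIntegral.integral_mono_on ht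
          ((hh.mul (by fun_prop)).abs.intervalIntegrable _ _)
          (Continuous.intervalIntegrable (by fun_prop) _ _) fun r _ => ?_
        rw [abs_mul, Real.abs_exp]
        exact mul_le_mul_of_nonneg_right (hB r) (Real.exp_nonneg _)
    _ ≤ _ := by
        rw [intervalIntegral.integral_const_mul]
        exact mul_le_mul_of_nonneg_left (integral_exp_neg_eigenvalue_mul_sub_le n t) hB0

theorem norm_e (n : ℕ+) : ‖e n‖ = 1 := orthonormal_e.1 n

theorem duhamel_heatSeries {a : ℕ+ → ℝ} (ha : Summable fun n => |a n| * (eigenvalue n)⁻¹)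
    {h : ℝ → ℝ} (hh : Continuous h) {B : ℝ} (hB : ∀ r, |h r| ≤ B) {t : ℝ} (ht : 0 ≤ t) :
    IntervalIntegrable (fun r => h r • heatSeries a (t - r)) volume 0 t ∧
      HasSum (fun n => (a n * modalConv h n t) • e n)
        (∫ r in (0 : ℝ)..t, h r • heatSeries a (t - r)) := by
  set F : ℕ+ → ℝ → L2 1 := fun n r =>
    (a n * (h r * Real.exp (-eigenvalue n * (t - r)))) • e n with hF
  have hFc : ∀ n, Continuous (F n) := fun n =>
    (continuous_const.mul (hh.mul (by fun_prop))).smul continuous_const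
  have hFi : ∀ n, IntegrableOn (F n) (Ioc 0 t) := fun n =>
    (intervalIntegrable_iff_integrableOn_Ioc_of_le ht).1 ((hFc n).intervalIntegrable _ _)
  have hFsum : Summable fun n => ∫ r in Ioc 0 t, ‖F n r‖ := by
    refine Summable.of_nonneg_of_le (fun n => integral_nonneg fun _ => norm_nonneg _)
      (fun n => ?_) (ha.mul_left B)
    rw [← intervalIntegral.integral_of_le ht]
    have := abs_modalConv_le hh.abs (B := B) (fun r => by rw [abs_abs]; exact hB r) n ht
    calc _ = |a n| * modalConv (fun r => |h r|) n t := by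
          rw [modalConv, ← intervalIntegral.integral_const_mul]
          refine intervalIntegral.integral_congr fun r _ => ?_
          simp only [hF]
          rw [norm_smul, norm_e, mul_one, Real.norm_eq_abs, abs_mul, abs_mul, Real.abs_exp]
      _ ≤ |a n| * (B * (eigenvalue n)⁻¹) := by
          gcongr
          exact (le_abs_self _).trans this
      _ = _ := by ring
  -- Valid also at r = t, where the series may diverge: `tsum_const_smul''` needs no summability.
  have heq : (fun r => h r • heatSeries a (t - r)) = fun r => ∑' n, F n r := by
    ext1 r
    rw [heatSeries, ← tsum_const_smul'']
    refine tsum_congr fun n => ?_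
    rw [smul_smul, hF]
    congr 1
    ring
  rw [heq]
  refine ⟨(intervalIntegrable_iff_integrableOn_Ioc_of_le ht).2
    (integrable_tsum_of_summable_integral_norm hFi hFsum), ?_⟩
  rw [intervalIntegral.integral_of_le ht]
  refine (hasSum_integral_of_summable_integral_norm hFi hFsum).congr_fun fun n => ?_
  rw [← intervalIntegral.integral_of_le ht, modalConv, intervalIntegral.integral_smul_const,
    intervalIntegral.integral_const_mul]

/-! ### The heat semigroup and mild solutions. -/

theorem summable_inner_e_sq (z : L2 1) : Summable fun n => (inner ℝ z (e n)) ^ 2 := by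
  refine (orthonormal_e.inner_products_summable (x := z)).congr fun n => ?_
  rw [real_inner_comm, Real.norm_eq_abs, sq_abs]

theorem norm_sum_smul_e_sq (s : Finset ℕ+) (c : ℕ+ → ℝ) :
    ‖∑ n ∈ s, c n • e n‖ ^ 2 = ∑ n ∈ s, c n ^ 2 := by
  rw [← real_inner_self_eq_norm_sq, orthonormal_e.inner_sum]
  simp [sq]

theorem abs_exp_neg_eigenvalue_mul_sq_le {t : ℝ} (ht : 0 ≤ t) (n : ℕ+) (c : ℝ) :
    (Real.exp (-eigenvalue n * t) * c) ^ 2 ≤ c ^ 2 := by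
  have h1 : Real.exp (-eigenvalue n * t) ≤ 1 :=
    Real.exp_le_one_iff.2 (by nlinarith [eigenvalue_pos n])
  rw [mul_pow]
  exact mul_le_of_le_one_left (sq_nonneg c) (pow_le_one₀ (Real.exp_nonneg _) h1)

theorem hasSum_heat (z : L2 1) {t : ℝ} (ht : 0 ≤ t) :
    HasSum (fun n => (Real.exp (-eigenvalue n * t) * inner ℝ z (e n)) • e n) (heat t z) := by
  refine Summable.hasSum ?_
  have := (orthonormal_e.orthogonalFamily.summable_iff_norm_sq_summable
    (fun n => Real.exp (-eigenvalue n * t) * inner ℝ z (e n))).2 ?_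
  · simpa using this
  · refine Summable.of_nonneg_of_le (fun _ => sq_nonneg _) (fun n => ?_) (summable_inner_e_sq z)
    rw [Real.norm_eq_abs, sq_abs]
    exact abs_exp_neg_eigenvalue_mul_sq_le ht n _

/-- By orthonormality the squared tails are at most those of ∑ ⟨z, e_n⟩², for every t ≥ 0. Partial
sums thus converge uniformly up to t = 0. -/
theorem continuousOn_heat (z : L2 1) : ContinuousOn (fun t => heat t z) (Ici 0) := by
  set c : ℕ+ → ℝ := fun n => inner ℝ z (e n) with hc
  have hs := summable_inner_e_sq z
  have hunif : TendstoUniformlyOn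
      (fun (s : Finset ℕ+) t => ∑ n ∈ s, (Real.exp (-eigenvalue n * t) * c n) • e n)
      (fun t => heat t z) Filter.atTop (Ici 0) := by
    rw [Metric.tendstoUniformlyOn_iff]
    intro ε hε
    have hev := (hs.hasSum : Filter.Tendsto _ _ _).eventually
      (lt_mem_nhds (sub_lt_self (∑' n, c n ^ 2) (pow_pos hε 2)))
    filter_upwards [hev] with s hsε t ht
    rw [dist_eq_norm]
    refine lt_of_pow_lt_pow_left₀ 2 hε.le ?_
    have hle : ‖heat t z - ∑ n ∈ s, (Real.exp (-eigenvalue n * t) * c n) • e n‖ ^ 2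
        ≤ ∑' n, c n ^ 2 - ∑ n ∈ s, c n ^ 2 := by
      refine le_of_tendsto (((Filter.Tendsto.sub_const (hasSum_heat z ht) _).norm).pow 2) ?_
      filter_upwards [Filter.eventually_ge_atTop s] with s' hs'
      rw [← Finset.sum_sdiff hs', add_sub_cancel_right, norm_sum_smul_e_sq]
      calc _ ≤ ∑ n ∈ s' \ s, c n ^ 2 :=
            Finset.sum_le_sum fun n _ => abs_exp_neg_eigenvalue_mul_sq_le ht n _
        _ = ∑ n ∈ s', c n ^ 2 - ∑ n ∈ s, c n ^ 2 := by rw [← Finset.sum_sdiff hs']; ring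
        _ ≤ _ := by
            gcongr
            exact hs.sum_le_tsum s' fun _ _ => sq_nonneg _
    linarith
  refine hunif.continuousOn (Filter.Eventually.frequently (Filter.Eventually.of_forall fun s => ?_))
  fun_prop

/-- The modal series of the forced part is dominated by B |f_n|/λ_n uniformly in t, which gives its
continuity. The expansion reduces z(T) = 0 to the moment equations. -/
theorem exists_mildSolution {s : ℝ} (hs : s ≤ 1) (f : NegSobolev s) {T : ℝ} {h : ℝ → ℝ}
    (hh : Continuous h) {B : ℝ} (hB : ∀ r, |h r| ≤ B) (z₀ : L2 1) {u : L2 T}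
    (hu : u =ᵐ[volume.restrict (Ioo (0 : ℝ) T)] h) :
    ∃ z, IsMildSolution f T u z₀ z ∧ ∀ t ∈ Icc 0 T,
      HasSum (fun n => (Real.exp (-eigenvalue n * t) * inner ℝ z₀ (e n)
        + f.coeff n * modalConv h n t) • e n) (z t) := by
  have ha := f.summable_abs_coeff_mul_inv hs
  have hae : ∀ t ∈ Icc (0 : ℝ) T, (fun r => u r • heatExt (t - r) f)
      =ᵐ[volume.restrict (uIoc 0 t)] fun r => h r • heatSeries f.coeff (t - r) := by
    intro t ht
    rw [uIoc_of_le ht.1]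
    have : u =ᵐ[volume.restrict (Ioc (0 : ℝ) t)] h := by
      rw [← restrict_Ioo_eq_restrict_Ioc]
      exact ae_restrict_of_ae_restrict_of_subset (Ioo_subset_Ioo_right ht.2) hu
    filter_upwards [this] with r hr
    rw [hr, heatExt]
  have hD := fun (t : ℝ) (ht : t ∈ Icc (0 : ℝ) T) => duhamel_heatSeries ha hh hB ht.1
  refine ⟨fun t => heat t z₀ + ∫ r in (0 : ℝ)..t, u r • heatExt (t - r) f, ⟨?_, ?_, ?_⟩, ?_⟩
  · refine ((continuousOn_heat z₀).mono fun t ht => ht.1).add ?_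
    have hc : ContinuousOn (fun t => ∑' n, (f.coeff n * modalConv h n t) • e n) (Icc 0 T) := by
      refine continuousOn_tsum (fun n => ?_) (ha.mul_left B) fun n t ht => ?_
      · exact ((continuous_const.mul (continuous_modalConv hh n)).smul
          continuous_const).continuousOn
      · rw [norm_smul, norm_e, mul_one, Real.norm_eq_abs, abs_mul]
        calc _ ≤ |f.coeff n| * (B * (eigenvalue n)⁻¹) := by
              gcongr; exact abs_modalConv_le hh hB n ht.1
          _ = _ := by ring
    refine hc.congr fun t ht => ?_
    rw [intervalIntegral.integral_congr_ae_restrict (hae t ht)]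
    exact (hD t ht).2.tsum_eq.symm
  · intro t ht
    exact (hD t ht).1.congr_ae (hae t ht).symm
  · exact fun _ _ => rfl
  · intro t ht
    simp only
    rw [intervalIntegral.integral_congr_ae_restrict (hae t ht)]
    simp_rw [add_smul]
    exact (hasSum_heat z₀ ht.1).add (hD t ht).2

end HeatControl

end

theorem proposition3p1 (C α s : ℝ) (hC : 0 < C) (hα : 0 < α) (hs : s ∈ Set.Ico (0 : ℝ) 1)
    (f : HeatControl.NegSobolev s)
    (hf : ∀ n : ℕ+, C * Real.exp (-α * Real.pi ^ 2 * (n : ℝ) ^ 2) ≤ |f.coeff n|)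
    (T : ℝ) (hT : α < T) :
    HeatControl.IsNullControllable f T := by
  have hT0 : 0 < T := hα.trans hT
  obtain ⟨K, hK, hctrl⟩ := HeatControl.exists_moment_control (T := T) (a := f.coeff) hC hα hT
    fun n => by simpa only [HeatControl.eigenvalue, ← mul_assoc] using hf n
  -- The sup bound K‖z₀‖ on (0,T) costs a factor √T in L².
  refine ⟨√T * K, by positivity, fun z₀ => ?_⟩
  obtain ⟨h, hh, hhb, hmom⟩ := hctrl (fun n => inner ℝ z₀ (HeatControl.e n)) ‖z₀‖ fun n => by
    simpa [HeatControl.norm_e] using abs_real_inner_le_norm z₀ (HeatControl.e n)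
  have hLp : MemLp h 2 (volume.restrict (Ioo (0 : ℝ) T)) :=
    MemLp.of_bound hh.aestronglyMeasurable (K * ‖z₀‖) (Filter.Eventually.of_forall hhb)
  obtain ⟨z, hz, hzsum⟩ := HeatControl.exists_mildSolution hs.2.le f hh hhb z₀ hLp.coeFn_toLp
  refine ⟨hLp.toLp h, z, hz, ?_, ?_⟩
  -- The moment equations make every coefficient of z(T) vanish.
  · refine (hzsum T ⟨hT0.le, le_rfl⟩).unique (hasSum_zero.congr_fun fun n => ?_)
    rw [HeatControl.modalConv, hmom, add_neg_cancel, zero_smul]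
  · have := Lp.norm_le_of_ae_bound (f := hLp.toLp h) (C := K * ‖z₀‖) (by positivity) (by
      filter_upwards [hLp.coeFn_toLp] with r hr
      rw [hr]
      exact hhb r)
    refine this.trans (le_of_eq ?_)
    have hvol : (measureUnivNNReal (volume.restrict (Ioo (0 : ℝ) T)) : ℝ) = T := by
      simp [measureUnivNNReal, ENNReal.coe_toNNReal_eq_toReal, hT0.le]
    rw [hvol, Real.sqrt_eq_rpow, mul_assoc]
    norm_num
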